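/- Let $k\ge 1$ be an integer, let $B\in[0,1]^{k\times k}$ be symmetric and let $c>0$. There are constants $C$ and $K$, depending only on $k$, $B$ and $c$, such that the following holds for every $n\ge 1$. Let $[n]$ be partitioned into $C_1,\dots,C_k$ with sizes $n_r=|C_r|\ge 2$ and $n_r\ge cn$ for all $r$, and let $G=([n],E)$ be a random graph in which the edges appear independently and $\mathbb P[\{i,j\}\in E]=B_{r,s}$ for $i\in C_r$, $j\in C_s$, $i\ne j$. For $1\le r\le s\le k$ let $C_{(r,s)}$ be the set of pairs $\{i,j\}\in\binom{[n]}{2}$ with $i\in C_r$, $j\in C_s$, and put $m_{r,s}=|C_{(r,s)}|$, $\widehat m_{r,s}=|C_{(r,s)}\cap E|$. For a graph $H$ let $A(L(H))$ be the adjacency matrix of its line graph (the graph on the edges of $H$ in which two distinct edges are adjacent when they share a vertex). Let $Q\in\mathbb R^{\binom n2\times\binom{k+1}2}$ have the entries $Q_{e,(r,s)}=m_{r,s}^{-1/2}$ if $e\in C_{(r,s)}$ and $0$ otherwise, and let $M=Q^TA(L(K_n))Q$. For $e\in C_{(r,s)}$ let $Y_e=\sqrt{m_{r,s}/\widehat m_{r,s}}$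 if $e\in E$ and $Y_e=0$ if $e\notin E$, and let $\hat Q\in\mathbb R^{|E|\times\binom{k+1}2}$ consist of the rows of $\mathrm{diag}(Y_e)\,Q$ indexed by $e\in E$. Then $\mathbb E[Y_e]$ takes the same value $\mu_{r,s}$ for all $e\in C_{(r,s)}$, and, with $\mathrm{diag}(\mu)$ the $\binom{k+1}2\times\binom{k+1}2$ diagonal matrix with entries $\mu_{r,s}$, $$\mathbb P\Big[\big\|\hat Q^TA(L(G))\hat Q-\mathrm{diag}(\mu)\,M\,\mathrm{diag}(\mu)\big\|_F\le C\,n^{3/4}\Big]\ \ge\ 1-\frac Kn .$$ -/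

import Mathlib

open MeasureTheory ProbabilityTheory Matrix
open scoped Matrix.Norms.Frobenius

namespace RandomLineGraph

/-- `G` is a random graph on `n` vertices drawn from the stochastic blockmodel with vertex
clustering `z` (vertex `i` lies in cluster `z i`) and connection probabilities `B`: the edges
appear independently, and `i ≠ j` are joined with probability `B (z i) (z j)`. -/
structure IsSBM {Ω : Type*} [MeasurableSpace Ω] (P : Measure Ω) {n k : ℕ}
    (z : Fin n → Fin k) (B : Matrix (Fin k) (Fin k) ℝ) (G : Ω → SimpleGraph (Fin n)) : Prop where
  measurableSet_edge : ∀ i j, MeasurableSet {ω | (G ω).Adj i j}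
  indep : iIndepSet
    (fun e : (⊤ : SimpleGraph (Fin n)).edgeSet => {ω | (e : Sym2 (Fin n)) ∈ (G ω).edgeSet}) P
  prob : ∀ i j, i ≠ j → P.real {ω | (G ω).Adj i j} = B (z i) (z j)

/-- The number of vertices in the cluster `r`. -/
def clusterSize {n k : ℕ} (z : Fin n → Fin k) (r : Fin k) : ℕ :=
  (Finset.univ.filter fun i => z i = r).card

/-- The number of edges of `G` in the block `b` of the induced partition. The blocks are indexed by
unordered pairs `s(r, s)` of clusters, and the edge `s(i, j)` lies in the block `s(z i, z j)`. -/
noncomputable def blockCount {n k : ℕ} (z : Fin n → Fin k) (G : SimpleGraph (Fin n))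
    (b : Sym2 (Fin k)) : ℕ :=
  {e : Sym2 (Fin n) | e ∈ G.edgeSet ∧ e.map z = b}.ncard

open Classical in
/-- The adjacency matrix of the line graph of `G`, indexed by the edges of `G`. -/
noncomputable def lineAdj {n : ℕ} (G : SimpleGraph (Fin n)) : Matrix G.edgeSet G.edgeSet ℝ :=
  G.lineGraph.adjMatrix ℝ

/-- The matrix of normalized block indicators. Its rows are indexed by the edges of the complete
graph, its columns by the blocks of the induced partition. -/
noncomputable def Q {n k : ℕ} (z : Fin n → Fin k) :
    Matrix (⊤ : SimpleGraph (Fin n)).edgeSet (Sym2 (Fin k)) ℝ :=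
  Matrix.of fun e b => if (e : Sym2 (Fin n)).map z = b then (√(blockCount z ⊤ b : ℝ))⁻¹ else 0

open Classical in
/-- The matrix `M = Qᵀ A(L(K_n)) Q`. -/
noncomputable def M {n k : ℕ} (z : Fin n → Fin k) : Matrix (Sym2 (Fin k)) (Sym2 (Fin k)) ℝ :=
  (Q z)ᵀ * lineAdj (⊤ : SimpleGraph (Fin n)) * Q z

open Classical in
/-- The weight `Y_e = δ_e √(m_e / m̂_e)`, where `δ_e` indicates whether `e` is an edge of `G`, and
`m_e` and `m̂_e` are the numbers of all possible edges and of edges of `G` in the block of `e`. -/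
noncomputable def Y {n k : ℕ} (z : Fin n → Fin k) (G : SimpleGraph (Fin n)) (e : Sym2 (Fin n)) :
    ℝ :=
  if e ∈ G.edgeSet then √((blockCount z ⊤ (e.map z) : ℝ) / (blockCount z G (e.map z) : ℝ)) else 0

open Classical in
/-- The padded matrix `diag(Y_e) Q`, with a zero row for every edge missing from `G`. -/
noncomputable def Qbar {n k : ℕ} (z : Fin n → Fin k) (G : SimpleGraph (Fin n)) :
    Matrix (⊤ : SimpleGraph (Fin n)).edgeSet (Sym2 (Fin k)) ℝ :=
  Matrix.diagonal (fun e : (⊤ : SimpleGraph (Fin n)).edgeSet => Y z G (e : Sym2 (Fin n))) * Q z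

/-- The matrix `Q̂`: the rows of the padded matrix that belong to the edges of `G`. -/
noncomputable def Qhat {n k : ℕ} (z : Fin n → Fin k) (G : SimpleGraph (Fin n)) :
    Matrix G.edgeSet (Sym2 (Fin k)) ℝ :=
  (Qbar z G).submatrix (Set.inclusion (SimpleGraph.edgeSet_mono le_top)) id

open Classical in
/-- The projected matrix `Q̂ᵀ A(L(G)) Q̂`. -/
noncomputable def projectedAdj {n k : ℕ} (z : Fin n → Fin k) (G : SimpleGraph (Fin n)) :
    Matrix (Sym2 (Fin k)) (Sym2 (Fin k)) ℝ :=
  (Qhat z G)ᵀ * lineAdj G * Qhat z G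

end RandomLineGraph

open RandomLineGraph

/-! For a block let `m` and `m̂` be the numbers of possible and of realised edges and `p` the edge
probability; let `T` be the number of ordered adjacent pairs of realised edges in the blocks `a`,
`b`. The weights cancel the normalization of `Q`, so the `(a, b)` entry of the projected matrix is
`T / (√m̂_a √m̂_b)` (`projectedAdj_apply`), and `M` is the same expression for the complete graph.

Both counts are sums of indicators, whose variance is at most the number of dependent pairs of
summands. This is `m` for `m̂`, and `O(n⁴)` for `T`, because two adjacent pairs are dependent only
if they share an edge. As every block has at least order `n²` possible edges, Chebyshev gives,
outside an event of probability `O(1/n)`, that `m̂ / m = p + O(n^(-1/2))` and that `T` is within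
`n^(5/2)` of its mean.

The edges of a block are exchangeable, so `E[Y_e]` is the mean of the block average of `Y`, which is
`√(m̂ / m)` (`integral_Y_eq_blockMean`); hence `μ = √p + O(n^(-1/2))`. Since `M = O(n)`, the entry
is `p_a p_b M / (√p_a √p_b) + O(√n) = μ_a M μ_b + O(√n)` (`abs_projectedAdj_sub_le`). If `p`
vanishes on one of the blocks, both sides are almost surely zero. A union bound over the entries,
whose number depends only on `k`, gives an error `O(√n)`, which is stronger than the claimed
`n^(3/4)`. -/

namespace RandomLineGraph

/-! ### Second moments of indicator sums, and exchangeability. -/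

section Probability

variable {Ω : Type*} [MeasurableSpace Ω] {P : Measure Ω}

theorem integrable_indicator_one [IsFiniteMeasure P] {A : Set Ω} (hA : MeasurableSet A) :
    Integrable (A.indicator (1 : Ω → ℝ)) P :=
  (integrable_const (1 : ℝ)).indicator hA

/-- The variance of a sum of indicators of events is at most the number of dependent pairs. -/
theorem integral_sq_sum_indicator_sub_le [IsProbabilityMeasure P] {X : Type*}
    (s : Finset X) (A : X → Set Ω) (hA : ∀ x, MeasurableSet (A x))
    (R : Finset (X × X))
    (hind : ∀ x ∈ s, ∀ y ∈ s, (x, y) ∉ R → P.real (A x ∩ A y) = P.real (A x) * P.real (A y)) :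
    ∫ ω, (∑ x ∈ s, (A x).indicator (1 : Ω → ℝ) ω - ∑ x ∈ s, P.real (A x)) ^ 2 ∂P ≤ R.card := by
  classical
  have hprod : ∀ x y ω, ((A x).indicator (1 : Ω → ℝ) ω - P.real (A x)) *
      ((A y).indicator (1 : Ω → ℝ) ω - P.real (A y)) =
      (A x ∩ A y).indicator (1 : Ω → ℝ) ω - P.real (A y) * (A x).indicator (1 : Ω → ℝ) ω
        - P.real (A x) * (A y).indicator (1 : Ω → ℝ) ω + P.real (A x) * P.real (A y) := by
    intro x y ω
    by_cases hx : ω ∈ A x <;> by_cases hy : ω ∈ A y <;> simp [hx, hy] <;> ring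
  have hint : ∀ x y, Integrable (fun ω => ((A x).indicator (1 : Ω → ℝ) ω - P.real (A x)) *
      ((A y).indicator (1 : Ω → ℝ) ω - P.real (A y))) P := by
    intro x y
    simp_rw [hprod]
    exact (((integrable_indicator_one ((hA x).inter (hA y))).sub
      ((integrable_indicator_one (hA x)).const_mul _)).sub
      ((integrable_indicator_one (hA y)).const_mul _)).add (integrable_const _)
  have hval : ∀ x y, ∫ ω, ((A x).indicator (1 : Ω → ℝ) ω - P.real (A x)) *
      ((A y).indicator (1 : Ω → ℝ) ω - P.real (A y)) ∂P =
      P.real (A x ∩ A y) - P.real (A x) * P.real (A y) := by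
    intro x y
    have hxy := integrable_indicator_one (P := P) ((hA x).inter (hA y))
    have hx := (integrable_indicator_one (P := P) (hA x)).const_mul (P.real (A y))
    have hy := (integrable_indicator_one (P := P) (hA y)).const_mul (P.real (A x))
    have hxyx : Integrable (fun ω => (A x ∩ A y).indicator (1 : Ω → ℝ) ω -
      P.real (A y) * (A x).indicator (1 : Ω → ℝ) ω) P := hxy.sub hx
    have hall : Integrable (fun ω => (A x ∩ A y).indicator (1 : Ω → ℝ) ω -
      P.real (A y) * (A x).indicator (1 : Ω → ℝ) ω -
      P.real (A x) * (A y).indicator (1 : Ω → ℝ) ω) P := hxyx.sub hy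
    simp_rw [hprod]
    rw [integral_add hall (integrable_const _), integral_sub hxyx hy, integral_sub hxy hx, integral_const_mul, integral_const_mul,
      integral_indicator_one ((hA x).inter (hA y)), integral_indicator_one (hA x),
      integral_indicator_one (hA y)]
    simp
    ring
  calc ∫ ω, (∑ x ∈ s, (A x).indicator (1 : Ω → ℝ) ω - ∑ x ∈ s, P.real (A x)) ^ 2 ∂P
      = ∑ x ∈ s, ∑ y ∈ s, (P.real (A x ∩ A y) - P.real (A x) * P.real (A y)) := by
        simp_rw [← Finset.sum_sub_distrib, sq, Finset.sum_mul_sum]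
        rw [integral_finsetSum _ fun x _ => integrable_finsetSum _ fun y _ => hint x y]
        refine Finset.sum_congr rfl fun x _ => ?_
        rw [integral_finsetSum _ fun y _ => hint x y]
        exact Finset.sum_congr rfl fun y _ => hval x y
    -- The covariance is zero off `R` and at most one on `R`.
    _ ≤ ∑ x ∈ s, ∑ y ∈ s, if (x, y) ∈ R then (1 : ℝ) else 0 := by
        refine Finset.sum_le_sum fun x hx => Finset.sum_le_sum fun y hy => ?_
        split_ifs with h
        · have h1 : P.real (A x ∩ A y) ≤ 1 := measureReal_le_one
          have h2 : 0 ≤ P.real (A x) * P.real (A y) := by positivity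
          linarith
        · rw [hind x hx y hy h, sub_self]
    _ = ((s ×ˢ s).filter (· ∈ R)).card := by
        rw [← Finset.sum_product', Finset.sum_boole]
    _ ≤ R.card := by
        exact_mod_cast Finset.card_le_card fun x hx => (Finset.mem_filter.1 hx).2

/-- Chebyshev's inequality for a bound on the second moment. -/
theorem measureReal_lt_abs_le {f : Ω → ℝ} [IsFiniteMeasure P]
    (hf : Integrable (fun ω => f ω ^ 2) P) {t v : ℝ} (ht : 0 < t)
    (hv : ∫ ω, f ω ^ 2 ∂P ≤ v) : P.real {ω | t < |f ω|} ≤ v / t ^ 2 := by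
  have h := mul_meas_ge_le_integral_of_nonneg (ae_of_all P fun ω => sq_nonneg (f ω)) hf (t ^ 2)
  rw [le_div_iff₀ (by positivity), mul_comm]
  refine le_trans (mul_le_mul_of_nonneg_left ?_ (by positivity)) (h.trans hv)
  refine measureReal_mono fun ω hω => ?_
  have hω' : t < |f ω| := hω
  show t ^ 2 ≤ f ω ^ 2
  rw [← sq_abs (f ω)]
  exact pow_le_pow_left₀ ht.le hω'.le 2

theorem measureReal_biInter_inter_biInter {ι : Type*} [DecidableEq ι] {A : ι → Set Ω}
    (h : iIndepSet A P) {S T : Finset ι} (hST : Disjoint S T) :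
    P.real ((⋂ i ∈ S, A i) ∩ ⋂ i ∈ T, A i) =
      P.real (⋂ i ∈ S, A i) * P.real (⋂ i ∈ T, A i) := by
  have h1 : ((⋂ i ∈ S, A i) ∩ ⋂ i ∈ T, A i) = ⋂ i ∈ S ∪ T, A i := by
    ext ω
    simp only [Set.mem_inter_iff, Set.mem_iInter, Finset.mem_union]
    exact ⟨fun h i hi => hi.elim (h.1 i) (h.2 i), fun h => ⟨fun i hi => h i (.inl hi),
      fun i hi => h i (.inr hi)⟩⟩
  rw [h1, measureReal_def, measureReal_def, measureReal_def, h.meas_biInter, h.meas_biInter,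
    h.meas_biInter, Finset.prod_union hST, ENNReal.toReal_mul]

open Classical in
/-- The probability that exactly the events indexed by `S` occur among the independent events
indexed by `a`, when all of these have probability `p`. -/
theorem measureReal_filter_eq [IsProbabilityMeasure P] {ι : Type*} {A : ι → Set Ω}
    (hA : ∀ i, MeasurableSet (A i)) (h : iIndepSet A P) {a S : Finset ι} (hS : S ⊆ a) {p : ℝ}
    (hp : ∀ i ∈ a, P.real (A i) = p) :
    P.real {ω | a.filter (fun i => ω ∈ A i) = S} =
      p ^ S.card * (1 - p) ^ (a.card - S.card) := by
  have h1 : {ω | a.filter (fun i => ω ∈ A i) = S} =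
      ⋂ i ∈ a, if i ∈ S then A i else (A i)ᶜ := by
    ext ω
    simp only [Set.mem_ofPred_eq, Set.mem_iInter, Finset.ext_iff, Finset.mem_filter]
    constructor
    · intro hω i hi
      have := hω i
      split_ifs with hiS
      · exact (this.2 hiS).2
      · exact fun hmem => hiS (this.1 ⟨hi, hmem⟩)
    · intro hω i
      constructor
      · rintro ⟨hi, hmem⟩
        by_contra hiS
        have := hω i hi
        rw [if_neg hiS] at this
        exact this hmem
      · intro hiS
        have := hω i (hS hiS)
        rw [if_pos hiS] at this
        exact ⟨hS hiS, this⟩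
  -- Independence is applied to the generated σ-algebras, which also contain the complements.
  have h2 := (iIndepSet_iff A P).1 h a (f := fun i => if i ∈ S then A i else (A i)ᶜ) (by
    intro i _
    split_ifs
    · exact MeasurableSpace.measurableSet_generateFrom (Set.mem_singleton _)
    · exact (MeasurableSpace.measurableSet_generateFrom (Set.mem_singleton _)).compl)
  rw [h1, measureReal_def, h2, ENNReal.toReal_prod]
  have h3 : ∀ i ∈ a, (P (if i ∈ S then A i else (A i)ᶜ)).toReal = if i ∈ S then p else 1 - p := by
    intro i hi
    split_ifs
    · exact hp i hi
    · rw [← measureReal_def, probReal_compl_eq_one_sub (hA i), hp i hi]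
  rw [Finset.prod_congr rfl h3, Finset.prod_ite, Finset.prod_const, Finset.prod_const,
    Finset.filter_mem_eq_inter, Finset.inter_eq_right.2 hS, ← Finset.sdiff_eq_filter,
    Finset.card_sdiff_of_subset hS]

open Classical in
/-- Independent equiprobable events are exchangeable. -/
theorem integral_ite_card_filter_eq [IsProbabilityMeasure P] {ι : Type*} {A : ι → Set Ω}
    (hA : ∀ i, MeasurableSet (A i)) (h : iIndepSet A P) {a : Finset ι} {p : ℝ}
    (hp : ∀ i ∈ a, P.real (A i) = p) (g : ℕ → ℝ) {e f : ι} (he : e ∈ a) (hf : f ∈ a) :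
    ∫ ω, (if ω ∈ A e then g (a.filter fun i => ω ∈ A i).card else 0) ∂P =
      ∫ ω, (if ω ∈ A f then g (a.filter fun i => ω ∈ A i).card else 0) ∂P := by
  have hmeas : ∀ S : Finset ι, MeasurableSet {ω | a.filter (fun i => ω ∈ A i) = S} := by
    intro S
    by_cases hS : S ⊆ a
    · have : {ω | a.filter (fun i => ω ∈ A i) = S} = ⋂ i ∈ a, {ω | ω ∈ A i ↔ i ∈ S} := by
        ext ω
        simp only [Set.mem_ofPred_eq, Set.mem_iInter, Finset.ext_iff, Finset.mem_filter]
        exact ⟨fun h i hi => by simpa [hi] using h i, fun h i =>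
          ⟨fun hi => (h i hi.1).1 hi.2, fun hi => ⟨hS hi, (h i (hS hi)).2 hi⟩⟩⟩
      rw [this]
      refine Finset.measurableSet_biInter _ fun i _ => ?_
      by_cases hi : i ∈ S
      · simpa [hi] using hA i
      · convert (hA i).compl using 1
        ext ω
        simp [hi]
    · have : {ω | a.filter (fun i => ω ∈ A i) = S} = ∅ := by
        ext ω
        simp only [Set.mem_ofPred_eq, Set.mem_empty_iff_false, iff_false]
        rintro rfl
        exact hS (Finset.filter_subset _ _)
      rw [this]
      exact MeasurableSet.empty
  -- Splitting by the exact set `S` of events that occur leaves a sum in which `e` enters only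
  -- through the condition `e ∈ S`.
  have key : ∀ e ∈ a, ∫ ω, (if ω ∈ A e then g (a.filter fun i => ω ∈ A i).card else 0) ∂P =
      ∑ S ∈ a.powerset, if e ∈ S then
        p ^ S.card * (1 - p) ^ (a.card - S.card) * g S.card else 0 := by
    intro e he
    have h1 : ∀ ω, (if ω ∈ A e then g (a.filter fun i => ω ∈ A i).card else 0) =
        ∑ S ∈ a.powerset, (if e ∈ S then g S.card else 0) *
          {ω | a.filter (fun i => ω ∈ A i) = S}.indicator (1 : Ω → ℝ) ω := by
      intro ω
      rw [Finset.sum_eq_single (a.filter fun i => ω ∈ A i)]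
      · simp [he]
      · intro S _ hS
        rw [Set.indicator_of_notMem (by simpa using hS.symm), mul_zero]
      · intro hn
        exact absurd (Finset.mem_powerset.2 (Finset.filter_subset _ _)) hn
    simp_rw [h1]
    rw [integral_finsetSum _ fun S _ => (integrable_indicator_one (hmeas S)).const_mul _]
    refine Finset.sum_congr rfl fun S hS => ?_
    rw [integral_const_mul, integral_indicator_one (hmeas S),
      measureReal_filter_eq hA h (Finset.mem_powerset.1 hS) hp]
    split_ifs <;> ring
  rw [key e he, key f hf]
  have hsw : ∀ i, Equiv.swap e f i ∈ a ↔ i ∈ a := by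
    intro i
    rcases eq_or_ne i e with rfl | hie
    · simp [he, hf]
    · rcases eq_or_ne i f with rfl | hif
      · simp [he, hf]
      · rw [Equiv.swap_apply_of_ne_of_ne hie hif]
  -- Swapping `e` and `f` permutes the subsets of `a`, keeps their cardinality and exchanges the two
  -- membership conditions.
  refine Finset.sum_equiv (Equiv.finsetCongr (Equiv.swap e f)) ?_ ?_
  · intro S
    simp only [Finset.mem_powerset, Equiv.finsetCongr_apply, Finset.subset_iff, Finset.mem_map,
      Equiv.coe_toEmbedding, forall_exists_index, and_imp, forall_apply_eq_imp_iff₂, hsw]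
  · intro S _
    simp [Equiv.finsetCongr_apply]

end Probability

/-! ### Sizes of blocks and numbers of adjacent and overlapping pairs. -/

section Counting

theorem card_le_mul_card_of_fibers {X Y : Type*} {R : Finset (X × Y)} {s : Finset X}
    {t : X → Finset Y} {N : ℕ} (hR : ∀ x ∈ R, x.1 ∈ s ∧ x.2 ∈ t x.1)
    (hN : ∀ x ∈ s, (t x).card ≤ N) : R.card ≤ N * s.card := by
  classical
  refine Finset.card_le_mul_card_image_of_maps_to (f := Prod.fst) (fun x hx => (hR x hx).1) _
    fun x hx => le_trans (Finset.card_le_card_of_injOn Prod.snd ?_ ?_) (hN x hx)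
  · intro y hy
    obtain ⟨hyR, rfl⟩ := Finset.mem_filter.1 hy
    exact (hR y hyR).2
  · intro y hy y' hy' h
    exact Prod.ext (((Finset.mem_filter.1 hy).2).trans (Finset.mem_filter.1 hy').2.symm) h

/-- The common entry `g` is one of the two entries of the first pair, and then the second pair is
`g` together with a neighbour of `g`, in one of two orders. This leaves `2 * (2 * N)` choices for
each first pair. -/
theorem card_le_of_overlapping {E : Type*} {A : Finset (E × E)} {nb : E → Finset E} {N : ℕ}
    (hN : ∀ e, (nb e).card ≤ N) (hA : ∀ x ∈ A, x.2 ∈ nb x.1 ∧ x.1 ∈ nb x.2)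
    {R : Finset ((E × E) × (E × E))}
    (hR : ∀ x ∈ R, (x.1 ∈ A ∧ x.2 ∈ A) ∧ ∃ g, (g = x.1.1 ∨ g = x.1.2) ∧ (g = x.2.1 ∨ g = x.2.2)) :
    R.card ≤ 4 * N * A.card := by
  classical
  let U : E → Finset (E × E) := fun g =>
    (nb g).image (fun f => (g, f)) ∪ (nb g).image fun f => (f, g)
  have hU : ∀ g, (U g).card ≤ N + N := fun g => (Finset.card_union_le _ _).trans
    (add_le_add (Finset.card_image_le.trans (hN g)) (Finset.card_image_le.trans (hN g)))
  refine card_le_mul_card_of_fibers (t := fun x => U x.1 ∪ U x.2) (fun x hx => ?_) fun x _ => ?_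
  · obtain ⟨⟨h1, h2⟩, g, hg1, hg2⟩ := hR x hx
    have hgU : x.2 ∈ U g := by
      rcases hg2 with rfl | rfl
      · exact Finset.mem_union_left _ (Finset.mem_image.2 ⟨x.2.2, (hA _ h2).1, rfl⟩)
      · exact Finset.mem_union_right _ (Finset.mem_image.2 ⟨x.2.1, (hA _ h2).2, rfl⟩)
    rcases hg1 with rfl | rfl
    · exact ⟨h1, Finset.mem_union_left _ hgU⟩
    · exact ⟨h1, Finset.mem_union_right _ hgU⟩
  · have := (Finset.card_union_le (U x.1) (U x.2)).trans (add_le_add (hU _) (hU _))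
    linarith

/-- The possible edges of a graph on `n` vertices. -/
abbrev Edge (n : ℕ) : Type := (⊤ : SimpleGraph (Fin n)).edgeSet

variable {n k : ℕ}

open Classical in
/-- The possible edges in the block `b`. -/
noncomputable def block (z : Fin n → Fin k) (b : Sym2 (Fin k)) : Finset (Edge n) :=
  Finset.univ.filter fun e => e.1.map z = b

open Classical in
/-- The edges sharing a vertex with `e`, including `e` itself. -/
noncomputable def touching (e : Edge n) : Finset (Edge n) :=
  Finset.univ.filter fun f => ∃ v, v ∈ e.1 ∧ v ∈ f.1

open Classical in
/-- The ordered pairs of distinct edges with a common vertex that lie in the blocks `a` and `b`. -/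
noncomputable def adjPairs (z : Fin n → Fin k) (a b : Sym2 (Fin k)) :
    Finset (Edge n × Edge n) :=
  (block z a ×ˢ block z b).filter fun x => x.1 ≠ x.2 ∧ ∃ v, v ∈ x.1.1 ∧ v ∈ x.2.1

open Classical in
/-- The pairs of elements of `adjPairs z a b` with an edge in common. -/
noncomputable def overlappingPairs (z : Fin n → Fin k) (a b : Sym2 (Fin k)) :
    Finset ((Edge n × Edge n) × (Edge n × Edge n)) :=
  (adjPairs z a b ×ˢ adjPairs z a b).filter fun x =>
    ∃ g, (g = x.1.1 ∨ g = x.1.2) ∧ (g = x.2.1 ∨ g = x.2.2)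

theorem mem_block {z : Fin n → Fin k} {b : Sym2 (Fin k)} {e : Edge n} :
    e ∈ block z b ↔ e.1.map z = b := by
  simp [block]

open Classical in
theorem blockCount_eq_card (z : Fin n → Fin k) (G : SimpleGraph (Fin n)) (b : Sym2 (Fin k)) :
    blockCount z G b = ((block z b).filter fun e => e.1 ∈ G.edgeSet).card := by
  have : {e : Sym2 (Fin n) | e ∈ G.edgeSet ∧ e.map z = b} =
      ((((block z b).filter fun e => e.1 ∈ G.edgeSet).map
        (Function.Embedding.subtype _) : Finset (Sym2 (Fin n))) : Set (Sym2 (Fin n))) := by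
    ext e
    simp only [Set.mem_ofPred_eq, Finset.coe_map, Set.mem_image, Finset.mem_coe,
      Finset.mem_filter, mem_block, Function.Embedding.subtype_apply]
    constructor
    · rintro ⟨h1, h2⟩
      exact ⟨⟨e, SimpleGraph.edgeSet_mono le_top h1⟩, ⟨h2, h1⟩, rfl⟩
    · rintro ⟨f, ⟨h2, h1⟩, rfl⟩
      exact ⟨h1, h2⟩
  rw [blockCount, this, Set.ncard_coe_finset, Finset.card_map]

theorem blockCount_top (z : Fin n → Fin k) (b : Sym2 (Fin k)) :
    blockCount z ⊤ b = (block z b).card := by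
  classical
  obtain ⟨G, hG⟩ : ∃ G : SimpleGraph (Fin n), G = ⊤ := ⟨_, rfl⟩
  rw [← hG, blockCount_eq_card, Finset.filter_true_of_mem fun e _ => hG ▸ e.2]

theorem blockCount_le (z : Fin n → Fin k) (G : SimpleGraph (Fin n)) (b : Sym2 (Fin k)) :
    blockCount z G b ≤ blockCount z ⊤ b := by
  classical
  rw [blockCount_top, blockCount_eq_card]
  exact Finset.card_filter_le _ _

open Classical in
theorem card_edge_le (n : ℕ) : (Finset.univ : Finset (Edge n)).card ≤ n ^ 2 := by
  have h : (Finset.univ : Finset (Edge n)).map (Function.Embedding.subtype _) ⊆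
      (Finset.univ : Finset (Fin n × Fin n)).image fun x => s(x.1, x.2) := by
    intro e _
    induction e with
    | h i j => exact Finset.mem_image.2 ⟨(i, j), Finset.mem_univ _, rfl⟩
  calc _ = _ := (Finset.card_map (Function.Embedding.subtype _)).symm
    _ ≤ _ := Finset.card_le_card h
    _ ≤ _ := Finset.card_image_le
    _ = n ^ 2 := by simp [sq]

/-- Ordered pairs of distinct vertices map at most two-to-one onto the edges of the block. The
subtracted one removes the diagonal when `r = s`, so both kinds of blocks are treated at once. -/
theorem clusterSize_mul_le (z : Fin n → Fin k) (r s : Fin k) :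
    clusterSize z r * (clusterSize z s - 1) ≤ 2 * blockCount z ⊤ s(r, s) := by
  classical
  rw [blockCount_top]
  let D : Finset (Σ _ : Fin n, Fin n) := (Finset.univ.filter fun i => z i = r).sigma
    fun i => (Finset.univ.filter fun j => z j = s).erase i
  have hD : clusterSize z r * (clusterSize z s - 1) ≤ D.card := by
    rw [Finset.card_sigma, clusterSize, ← smul_eq_mul]
    refine Finset.card_nsmul_le_sum _ _ _ fun i _ => ?_
    exact Finset.pred_card_le_card_erase
  refine hD.trans ?_
  have hne : ∀ x ∈ D, x.1 ≠ x.2 := by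
    intro x hx
    simp only [D, Finset.mem_sigma, Finset.mem_erase] at hx
    exact hx.2.1.symm
  have h2 : (block z s(r, s)).card = ((block z s(r, s)).map
      (Function.Embedding.subtype _)).card := (Finset.card_map _).symm
  rw [h2]
  refine Finset.card_le_mul_card_image_of_maps_to (f := fun x => s(x.1, x.2)) ?_ 2 ?_
  · intro x hx
    have hx' := hne x hx
    simp only [D, Finset.mem_sigma, Finset.mem_erase, Finset.mem_filter] at hx
    refine Finset.mem_map.2 ⟨⟨s(x.1, x.2), by simpa using hx'⟩, ?_, rfl⟩
    rw [mem_block, Sym2.map_mk, hx.1.2, hx.2.2.2]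
  · intro e _
    induction e with
    | h i j =>
      refine (Finset.card_le_card (t := {⟨i, j⟩, ⟨j, i⟩}) ?_).trans Finset.card_le_two
      rintro ⟨u, v⟩ hx
      rw [Finset.mem_filter] at hx
      rcases Sym2.eq_iff.1 hx.2 with ⟨rfl, rfl⟩ | ⟨rfl, rfl⟩ <;> simp

theorem blockCount_top_ge {z : Fin n → Fin k} {c : ℝ} (hc : 0 < c)
    (h2 : ∀ r, 2 ≤ clusterSize z r) (hcn : ∀ r, c * (n : ℝ) ≤ (clusterSize z r : ℝ))
    (b : Sym2 (Fin k)) : c ^ 2 / 4 * (n : ℝ) ^ 2 ≤ blockCount z ⊤ b := by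
  induction b with
  | h r s =>
    have h : (clusterSize z r : ℝ) * ((clusterSize z s : ℝ) - 1) ≤ 2 * blockCount z ⊤ s(r, s) := by
      have := clusterSize_mul_le z r s
      rw [← Nat.cast_one, ← Nat.cast_sub (by linarith [h2 s])]
      exact_mod_cast this
    have hs : (2 : ℝ) ≤ clusterSize z s := by exact_mod_cast h2 s
    -- A cluster size of at least two satisfies `x - 1 ≥ x / 2`.
    have h3 : c * n * (c * n / 2) ≤ (clusterSize z r : ℝ) * ((clusterSize z s : ℝ) - 1) :=
      mul_le_mul (hcn r) (by linarith [hcn s]) (by positivity) (by positivity)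
    linarith

theorem blockCount_top_pos {z : Fin n → Fin k} (h2 : ∀ r, 2 ≤ clusterSize z r)
    (b : Sym2 (Fin k)) : 0 < blockCount z ⊤ b := by
  induction b with
  | h r s =>
    have h := clusterSize_mul_le z r s
    have h1 : 0 < clusterSize z r * (clusterSize z s - 1) :=
      Nat.mul_pos (by linarith [h2 r]) (by have := h2 s; omega)
    omega

theorem card_touching_le (e : Edge n) : (touching e).card ≤ 2 * n := by
  classical
  obtain ⟨e, he⟩ := e
  induction e with
  | h i j =>
    have h : (touching ⟨s(i, j), he⟩).map (Function.Embedding.subtype _) ⊆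
        (Finset.univ.image fun w => s(i, w)) ∪ Finset.univ.image fun w => s(j, w) := by
      intro f hf
      obtain ⟨f', hf', rfl⟩ := Finset.mem_map.1 hf
      obtain ⟨v, hv, hvf⟩ := (Finset.mem_filter.1 hf').2
      obtain ⟨w, hw⟩ := Sym2.mem_iff_exists.1 hvf
      have hfw : (Function.Embedding.subtype _) f' = s(v, w) := hw
      rw [hfw, Finset.mem_union, Finset.mem_image, Finset.mem_image]
      rcases Sym2.mem_iff.1 hv with rfl | rfl
      · exact .inl ⟨w, Finset.mem_univ _, rfl⟩
      · exact .inr ⟨w, Finset.mem_univ _, rfl⟩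
    calc _ = _ := (Finset.card_map (Function.Embedding.subtype _)).symm
      _ ≤ _ := Finset.card_le_card h
      _ ≤ _ := Finset.card_union_le _ _
      _ ≤ n + n := add_le_add (Finset.card_image_le.trans (by simp))
          (Finset.card_image_le.trans (by simp))
      _ = 2 * n := by ring

theorem mem_adjPairs {z : Fin n → Fin k} {a b : Sym2 (Fin k)} {x : Edge n × Edge n} :
    x ∈ adjPairs z a b ↔ (x.1 ∈ block z a ∧ x.2 ∈ block z b) ∧
      x.1 ≠ x.2 ∧ ∃ v, v ∈ x.1.1 ∧ v ∈ x.2.1 := by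
  simp [adjPairs]

theorem card_adjPairs_le (z : Fin n → Fin k) (a b : Sym2 (Fin k)) :
    (adjPairs z a b).card ≤ 2 * n ^ 3 := by
  classical
  calc _ ≤ 2 * n * (Finset.univ : Finset (Edge n)).card :=
        card_le_mul_card_of_fibers (t := touching) (fun x hx => ⟨Finset.mem_univ _,
          Finset.mem_filter.2 ⟨Finset.mem_univ _, (mem_adjPairs.1 hx).2.2⟩⟩)
          fun e _ => card_touching_le e
    _ ≤ 2 * n * n ^ 2 := Nat.mul_le_mul_left _ (card_edge_le n)
    _ = 2 * n ^ 3 := by ring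

theorem mem_overlappingPairs {z : Fin n → Fin k} {a b : Sym2 (Fin k)}
    {x : (Edge n × Edge n) × (Edge n × Edge n)} :
    x ∈ overlappingPairs z a b ↔ (x.1 ∈ adjPairs z a b ∧ x.2 ∈ adjPairs z a b) ∧
      ∃ g, (g = x.1.1 ∨ g = x.1.2) ∧ (g = x.2.1 ∨ g = x.2.2) := by
  rw [overlappingPairs, Finset.mem_filter, Finset.mem_product]

theorem card_overlappingPairs_le (z : Fin n → Fin k) (a b : Sym2 (Fin k)) :
    (overlappingPairs z a b).card ≤ 16 * n ^ 4 := by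
  calc _ ≤ 4 * (2 * n) * (adjPairs z a b).card := by
        refine card_le_of_overlapping (nb := touching) card_touching_le (fun x hx => ?_)
          fun x hx => mem_overlappingPairs.1 hx
        obtain ⟨-, -, v, hv1, hv2⟩ := mem_adjPairs.1 hx
        exact ⟨Finset.mem_filter.2 ⟨Finset.mem_univ _, v, hv1, hv2⟩,
          Finset.mem_filter.2 ⟨Finset.mem_univ _, v, hv2, hv1⟩⟩
    _ ≤ 4 * (2 * n) * (2 * n ^ 3) := Nat.mul_le_mul_left _ (card_adjPairs_le z a b)
    _ = 16 * n ^ 4 := by ring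

/-! ### Entries of the projected matrices in terms of counts. -/

open Classical in
theorem sum_edgeSet_eq (G : SimpleGraph (Fin n)) [Fintype G.edgeSet] (F : Edge n → ℝ) :
    ∑ e : G.edgeSet, F (Set.inclusion (SimpleGraph.edgeSet_mono le_top) e) =
      ∑ e : Edge n, if e.1 ∈ G.edgeSet then F e else 0 := by
  rw [← Finset.sum_filter]
  refine Finset.sum_bij (fun e _ => Set.inclusion (SimpleGraph.edgeSet_mono le_top) e)
    (fun e _ => by simp)
    (fun e _ f _ h => Set.inclusion_injective (SimpleGraph.edgeSet_mono le_top) h)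
    (fun e he => ⟨⟨e.1, (Finset.mem_filter.1 he).2⟩, Finset.mem_univ _, rfl⟩)
    fun e _ => rfl

-- The weight `√(m / m̂)` turns the normalization `1 / √m` of `Q` into `1 / √m̂`.
open Classical in
theorem Qhat_apply {z : Fin n → Fin k} {G : SimpleGraph (Fin n)} (e : G.edgeSet)
    (b : Sym2 (Fin k)) :
    Qhat z G e b = if Set.inclusion (SimpleGraph.edgeSet_mono le_top) e ∈ block z b then
      (√(blockCount z G b : ℝ))⁻¹ else 0 := by
  simp only [Qhat, Qbar, submatrix_apply, diagonal_mul, Q, of_apply, Y,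
    mem_block, id, e.2, if_true]
  split_ifs with h
  · subst h
    have hpos : 0 < blockCount z ⊤ (e.1.map z) := by
      rw [blockCount_top]
      exact Finset.card_pos.2 ⟨⟨e.1, SimpleGraph.edgeSet_mono le_top e.2⟩, mem_block.2 rfl⟩
    have : (√(blockCount z ⊤ (e.1.map z) : ℝ)) ≠ 0 := by positivity
    rw [Real.sqrt_div (by positivity)]
    field_simp
  · simp

/-- The number of ordered pairs of adjacent edges of `G` in the blocks `a` and `b`. -/
noncomputable def adjCount (z : Fin n → Fin k) (G : SimpleGraph (Fin n)) (a b : Sym2 (Fin k)) :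
    ℝ :=
  open Classical in
  ∑ x ∈ adjPairs z a b, if x.1.1 ∈ G.edgeSet ∧ x.2.1 ∈ G.edgeSet then 1 else 0

theorem projectedAdj_apply (z : Fin n → Fin k) (G : SimpleGraph (Fin n)) (a b : Sym2 (Fin k)) :
    projectedAdj z G a b =
      adjCount z G a b / (√(blockCount z G a : ℝ) * √(blockCount z G b : ℝ)) := by
  classical
  let F : Edge n → Edge n → ℝ := fun e f =>
    (if e ∈ block z a then (√(blockCount z G a : ℝ))⁻¹ else 0) *
    (if e ≠ f ∧ ∃ v, v ∈ e.1 ∧ v ∈ f.1 then 1 else 0) *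
    (if f ∈ block z b then (√(blockCount z G b : ℝ))⁻¹ else 0)
  have hF : ∀ e f : G.edgeSet, Qhat z G e a * lineAdj G e f * Qhat z G f b =
      F (Set.inclusion (SimpleGraph.edgeSet_mono le_top) e)
        (Set.inclusion (SimpleGraph.edgeSet_mono le_top) f) := by
    intro e f
    simp only [F, Qhat_apply, lineAdj, SimpleGraph.adjMatrix_apply,
      SimpleGraph.lineGraph_adj_iff_exists, ne_eq, Set.inclusion_inj]
  calc projectedAdj z G a b
      = ∑ f : G.edgeSet, ∑ e : G.edgeSet, Qhat z G e a * lineAdj G e f * Qhat z G f b := by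
        simp only [projectedAdj, mul_apply, transpose_apply, Finset.sum_mul]
    _ = ∑ f : Edge n, ∑ e : Edge n, if f.1 ∈ G.edgeSet then
          (if e.1 ∈ G.edgeSet then F e f else 0) else 0 := by
        simp_rw [hF]
        rw [sum_edgeSet_eq G fun f => ∑ e : G.edgeSet,
          F (Set.inclusion (SimpleGraph.edgeSet_mono le_top) e) f]
        refine Finset.sum_congr rfl fun f _ => ?_
        rw [sum_edgeSet_eq G fun e => F e f]
        split_ifs <;> simp
    _ = ∑ x : Edge n × Edge n, if x ∈ adjPairs z a b then
          (if x.1.1 ∈ G.edgeSet ∧ x.2.1 ∈ G.edgeSet then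
            (√(blockCount z G a : ℝ) * √(blockCount z G b : ℝ))⁻¹ else 0) else 0 := by
        rw [Fintype.sum_prod_type_right]
        refine Finset.sum_congr rfl fun f _ => Finset.sum_congr rfl fun e _ => ?_
        simp only [F, mem_adjPairs]
        by_cases h1 : f.1 ∈ G.edgeSet <;> by_cases h2 : e.1 ∈ G.edgeSet <;>
          by_cases h3 : e ∈ block z a <;> by_cases h4 : f ∈ block z b <;>
          by_cases h5 : e = f <;>
          by_cases h6 : ∃ v, v ∈ e.1 ∧ v ∈ f.1 <;>
          simp only [h1, h2, h3, h4, h5, h6, ne_eq, not_true, not_false_eq_true, if_true, if_false,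
            and_true, and_false, false_and, mul_one, mul_zero, zero_mul, mul_inv]
    _ = _ := by
        rw [← Finset.sum_filter, Finset.filter_mem_eq_inter, Finset.univ_inter, adjCount,
          Finset.sum_div]
        refine Finset.sum_congr rfl fun x _ => ?_
        split_ifs <;> simp

/-- For the complete graph `m̂ = m`, so that one entry formula serves both matrices. -/
theorem M_eq_projectedAdj_top {z : Fin n → Fin k} : M z = projectedAdj z ⊤ := by
  classical
  have h : Q z = Qhat z ⊤ := by
    ext e b
    rw [Qhat_apply]
    simp [Q, mem_block]
  rw [M, projectedAdj, h]
  congr!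

theorem M_apply (z : Fin n → Fin k) (a b : Sym2 (Fin k)) :
    M z a b = (adjPairs z a b).card /
      (√(blockCount z ⊤ a : ℝ) * √(blockCount z ⊤ b : ℝ)) := by
  classical
  have h : adjCount z ⊤ a b = ∑ x ∈ adjPairs z a b, (1 : ℝ) :=
    Finset.sum_congr rfl fun x _ => if_pos ⟨x.1.2, x.2.2⟩
  rw [M_eq_projectedAdj_top, projectedAdj_apply, h, Finset.sum_const, nsmul_eq_mul, mul_one]

end Counting

/-! ### Moments of the counts and of the weights in the blockmodel. -/

section Blockmodel

variable {Ω : Type*} {n k : ℕ} {z : Fin n → Fin k} {G : Ω → SimpleGraph (Fin n)}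

/-- The event that `e` is an edge of the random graph `G`. -/
def edgeEvent (G : Ω → SimpleGraph (Fin n)) (e : Edge n) : Set Ω :=
  {ω | e.1 ∈ (G ω).edgeSet}

theorem mem_edgeEvent {e : Edge n} {ω : Ω} : ω ∈ edgeEvent G e ↔ e.1 ∈ (G ω).edgeSet := Iff.rfl

theorem blockCount_eq_sum_indicator (ω : Ω) (b : Sym2 (Fin k)) :
    (blockCount z (G ω) b : ℝ) =
      ∑ e ∈ block z b, (edgeEvent G e).indicator (1 : Ω → ℝ) ω := by
  classical
  simp only [blockCount_eq_card, Set.indicator_apply, mem_edgeEvent, Pi.one_apply,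
    Finset.sum_boole]

theorem adjCount_eq_sum_indicator (ω : Ω) (a b : Sym2 (Fin k)) :
    adjCount z (G ω) a b =
      ∑ x ∈ adjPairs z a b, (edgeEvent G x.1 ∩ edgeEvent G x.2).indicator (1 : Ω → ℝ) ω := by
  classical
  simp only [adjCount, Set.indicator_apply, Set.mem_inter_iff, mem_edgeEvent, Pi.one_apply]

theorem blockCount_div_le_one (G : SimpleGraph (Fin n)) (b : Sym2 (Fin k)) :
    (blockCount z G b : ℝ) / blockCount z ⊤ b ≤ 1 :=
  div_le_one_of_le₀ (by exact_mod_cast blockCount_le z G b) (by positivity)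

theorem adjCount_le (G : SimpleGraph (Fin n)) (a b : Sym2 (Fin k)) :
    adjCount z G a b ≤ (adjPairs z a b).card := by
  classical
  rw [adjCount, Finset.sum_boole]
  exact_mod_cast Finset.card_filter_le _ _

theorem adjCount_nonneg (G : SimpleGraph (Fin n)) (a b : Sym2 (Fin k)) :
    0 ≤ adjCount z G a b := by
  classical
  rw [adjCount, Finset.sum_boole]
  positivity

variable [MeasurableSpace Ω] {P : Measure Ω} {B : Matrix (Fin k) (Fin k) ℝ}
  {p : Sym2 (Fin k) → ℝ}

theorem IsSBM.measurableSet_edgeEvent (h : IsSBM P z B G) (e : Edge n) :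
    MeasurableSet (edgeEvent G e) := by
  obtain ⟨e, he⟩ := e
  induction e with
  | h i j => exact h.measurableSet_edge i j

theorem IsSBM.iIndepSet_edgeEvent (h : IsSBM P z B G) : iIndepSet (edgeEvent G) P := h.indep

theorem IsSBM.measureReal_edgeEvent (h : IsSBM P z B G) (hp : ∀ r s, p s(r, s) = B r s)
    (e : Edge n) : P.real (edgeEvent G e) = p (e.1.map z) := by
  obtain ⟨e, he⟩ := e
  induction e with
  | h i j =>
    rw [Sym2.map_mk, hp]
    exact h.prob i j (by simpa using he)

theorem IsSBM.measurable_blockCount (h : IsSBM P z B G) (b : Sym2 (Fin k)) :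
    Measurable fun ω => (blockCount z (G ω) b : ℝ) := by
  simp_rw [blockCount_eq_sum_indicator]
  exact Finset.measurable_fun_sum _ fun e _ =>
    measurable_one.indicator (h.measurableSet_edgeEvent e)

theorem IsSBM.measurable_adjCount (h : IsSBM P z B G) (a b : Sym2 (Fin k)) :
    Measurable fun ω => adjCount z (G ω) a b := by
  simp_rw [adjCount_eq_sum_indicator]
  exact Finset.measurable_fun_sum _ fun x _ => measurable_one.indicator
    ((h.measurableSet_edgeEvent x.1).inter (h.measurableSet_edgeEvent x.2))

theorem integrable_of_abs_le [IsFiniteMeasure P] {f : Ω → ℝ} (hf : Measurable f) {D : ℝ}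
    (hD : ∀ ω, |f ω| ≤ D) : Integrable f P :=
  Integrable.of_bound hf.aestronglyMeasurable D (ae_of_all _ hD)

theorem IsSBM.integrable_sq_blockCount_sub [IsFiniteMeasure P] (h : IsSBM P z B G)
    (b : Sym2 (Fin k)) (t : ℝ) :
    Integrable (fun ω => ((blockCount z (G ω) b : ℝ) - t) ^ 2) P := by
  refine integrable_of_abs_le (((h.measurable_blockCount b).sub_const t).pow_const 2)
    (D := (blockCount z ⊤ b + |t|) ^ 2) fun ω => ?_
  rw [abs_pow]
  refine pow_le_pow_left₀ (abs_nonneg _) ((abs_sub _ _).trans ?_) 2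
  have : (blockCount z (G ω) b : ℝ) ≤ blockCount z ⊤ b := by exact_mod_cast blockCount_le z _ b
  rw [abs_of_nonneg (by positivity : (0 : ℝ) ≤ blockCount z (G ω) b)]
  linarith

theorem IsSBM.integrable_sq_adjCount_sub [IsFiniteMeasure P] (h : IsSBM P z B G)
    (a b : Sym2 (Fin k)) (t : ℝ) :
    Integrable (fun ω => (adjCount z (G ω) a b - t) ^ 2) P := by
  refine integrable_of_abs_le (((h.measurable_adjCount a b).sub_const t).pow_const 2)
    (D := ((adjPairs z a b).card + |t|) ^ 2) fun ω => ?_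
  rw [abs_pow]
  refine pow_le_pow_left₀ (abs_nonneg _) ((abs_sub _ _).trans ?_) 2
  rw [abs_of_nonneg (adjCount_nonneg _ a b)]
  linarith [adjCount_le (z := z) (G ω) a b]

theorem IsSBM.integral_sq_blockCount_sub_le [IsProbabilityMeasure P] (h : IsSBM P z B G)
    (hp : ∀ r s, p s(r, s) = B r s) (b : Sym2 (Fin k)) :
    ∫ ω, ((blockCount z (G ω) b : ℝ) - blockCount z ⊤ b * p b) ^ 2 ∂P ≤ blockCount z ⊤ b := by
  classical
  have h1 : ∑ e ∈ block z b, P.real (edgeEvent G e) = blockCount z ⊤ b * p b := by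
    rw [Finset.sum_congr rfl fun e he => (h.measureReal_edgeEvent hp e).trans
      (congrArg p (mem_block.1 he)), Finset.sum_const, nsmul_eq_mul, blockCount_top]
  -- Distinct edges are independent, so only the diagonal pairs contribute.
  have h2 := integral_sq_sum_indicator_sub_le (P := P) (block z b) (edgeEvent G)
    h.measurableSet_edgeEvent (block z b).diag fun e he f hf hef => by
      have hne : e ≠ f := fun heq => hef (Finset.mem_diag.2 ⟨he, heq⟩)
      have := measureReal_biInter_inter_biInter h.iIndepSet_edgeEvent (S := {e}) (T := {f})
        (by simpa using hne)
      simpa using this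
  rw [h1, Finset.diag_card, ← blockCount_top] at h2
  simpa only [← blockCount_eq_sum_indicator] using h2

theorem IsSBM.integral_sq_adjCount_sub_le [IsProbabilityMeasure P] (h : IsSBM P z B G)
    (hp : ∀ r s, p s(r, s) = B r s) (a b : Sym2 (Fin k)) :
    ∫ ω, (adjCount z (G ω) a b - (adjPairs z a b).card * (p a * p b)) ^ 2 ∂P
      ≤ 16 * (n : ℝ) ^ 4 := by
  classical
  have hS : ∀ x : Edge n × Edge n, edgeEvent G x.1 ∩ edgeEvent G x.2 =
      ⋂ i ∈ ({x.1, x.2} : Finset (Edge n)), edgeEvent G i := by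
    intro x
    ext ω
    simp
  have h0 : ∀ x ∈ adjPairs z a b, P.real (edgeEvent G x.1 ∩ edgeEvent G x.2) = p a * p b := by
    intro x hx
    obtain ⟨⟨ha, hb⟩, hne, -⟩ := mem_adjPairs.1 hx
    have := measureReal_biInter_inter_biInter h.iIndepSet_edgeEvent (S := {x.1}) (T := {x.2})
        (by simpa using hne)
    simp only [Finset.mem_singleton, Set.iInter_iInter_eq_left] at this
    rw [this, h.measureReal_edgeEvent hp, h.measureReal_edgeEvent hp, mem_block.1 ha,
      mem_block.1 hb]
  have h1 : ∑ x ∈ adjPairs z a b, P.real (edgeEvent G x.1 ∩ edgeEvent G x.2) =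
      (adjPairs z a b).card * (p a * p b) := by
    rw [Finset.sum_congr rfl h0, Finset.sum_const, nsmul_eq_mul]
  have h2 := integral_sq_sum_indicator_sub_le (P := P) (adjPairs z a b)
    (fun x => edgeEvent G x.1 ∩ edgeEvent G x.2)
    (fun x => (h.measurableSet_edgeEvent x.1).inter (h.measurableSet_edgeEvent x.2))
    (overlappingPairs z a b) fun x hx y hy hxy => by
      rw [hS, hS]
      refine measureReal_biInter_inter_biInter h.iIndepSet_edgeEvent ?_
      -- If the two index sets meet, the pairs share an edge and are among the overlapping ones.
      by_contra hd
      obtain ⟨g, hg1, hg2⟩ := Finset.not_disjoint_iff.1 hd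
      exact hxy (mem_overlappingPairs.2 ⟨⟨hx, hy⟩, g, by simpa using hg1, by simpa using hg2⟩)
  rw [h1] at h2
  simp only [← adjCount_eq_sum_indicator] at h2
  exact h2.trans (by exact_mod_cast card_overlappingPairs_le z a b)

/-- The expectation of `√(m̂_b / m_b)`. -/
noncomputable def blockMean (P : Measure Ω) (z : Fin n → Fin k) (G : Ω → SimpleGraph (Fin n))
    (b : Sym2 (Fin k)) : ℝ :=
  ∫ ω, √((blockCount z (G ω) b : ℝ) / blockCount z ⊤ b) ∂P

theorem IsSBM.integrable_sqrt_blockCount_div [IsFiniteMeasure P] (h : IsSBM P z B G)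
    (b : Sym2 (Fin k)) :
    Integrable (fun ω => √((blockCount z (G ω) b : ℝ) / blockCount z ⊤ b)) P := by
  refine integrable_of_abs_le ((h.measurable_blockCount b).div_const _).sqrt (D := 1) fun ω => ?_
  rw [abs_of_nonneg (Real.sqrt_nonneg _)]
  exact Real.sqrt_le_one.2 (blockCount_div_le_one _ b)

theorem blockMean_nonneg (P : Measure Ω) (z : Fin n → Fin k) (G : Ω → SimpleGraph (Fin n))
    (b : Sym2 (Fin k)) : 0 ≤ blockMean P z G b :=
  integral_nonneg fun _ => Real.sqrt_nonneg _

theorem IsSBM.blockMean_le_one [IsProbabilityMeasure P] (h : IsSBM P z B G)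
    (b : Sym2 (Fin k)) : blockMean P z G b ≤ 1 := by
  have := integral_mono (h.integrable_sqrt_blockCount_div b) (integrable_const (1 : ℝ))
    fun ω => Real.sqrt_le_one.2 (blockCount_div_le_one (z := z) (G ω) b)
  exact this.trans_eq (by simp)

theorem abs_sqrt_sub_sqrt_le {x p : ℝ} (hx : 0 ≤ x) (hp : 0 < p) :
    |√x - √p| ≤ |x - p| / √p := by
  have hs : 0 < √p := Real.sqrt_pos.2 hp
  rw [le_div_iff₀ hs]
  have h1 : x - p = (√x - √p) * (√x + √p) := by
    nlinarith [Real.sq_sqrt hx, Real.sq_sqrt hp.le]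
  rw [h1, abs_mul]
  refine mul_le_mul_of_nonneg_left ?_ (abs_nonneg _)
  rw [abs_of_pos (by positivity)]
  linarith [Real.sqrt_nonneg x]

/-- The first moment of `|m̂ / m - p|` is controlled by the second through `|y| ≤ q y² + 1 / q`. The
free parameter `q` is later taken to be `√n`. -/
theorem IsSBM.abs_blockMean_sub_le [IsProbabilityMeasure P] (h : IsSBM P z B G)
    (hp : ∀ r s, p s(r, s) = B r s) {b : Sym2 (Fin k)} (hm : 0 < blockCount z ⊤ b)
    (hb : 0 < p b) {q : ℝ} (hq : 0 < q) :
    |blockMean P z G b - √(p b)| ≤ (q / blockCount z ⊤ b + 1 / q) / √(p b) := by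
  set m : ℝ := (blockCount z ⊤ b : ℝ)
  have hm' : 0 < m := Nat.cast_pos.2 hm
  have hs : 0 < √(p b) := Real.sqrt_pos.2 hb
  have hpt : ∀ ω, |√((blockCount z (G ω) b : ℝ) / m) - √(p b)| ≤
      (q / m ^ 2 * ((blockCount z (G ω) b : ℝ) - m * p b) ^ 2 + 1 / q) / √(p b) := by
    intro ω
    refine (abs_sqrt_sub_sqrt_le (by positivity) hb).trans ?_
    gcongr
    set y : ℝ := (blockCount z (G ω) b : ℝ) / m - p b with hy
    have h1 : q / m ^ 2 * ((blockCount z (G ω) b : ℝ) - m * p b) ^ 2 = q * |y| ^ 2 := by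
      rw [sq_abs, hy]
      field_simp
    rw [h1, ← sub_nonneg]
    have h2 : q * |y| ^ 2 + 1 / q - |y| = ((q * |y| - 1 / 2) ^ 2 + 3 / 4) / q := by
      field_simp
      ring
    rw [h2]
    positivity
  have hi := (h.integrable_sq_blockCount_sub b (m * p b)).const_mul (q / m ^ 2)
  have hi2 : Integrable (fun ω => (q / m ^ 2 * ((blockCount z (G ω) b : ℝ) - m * p b) ^ 2
      + 1 / q) / √(p b)) P := (hi.add (integrable_const _)).div_const _
  have hsub : blockMean P z G b - √(p b) =
      ∫ ω, (√((blockCount z (G ω) b : ℝ) / m) - √(p b)) ∂P := by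
    rw [integral_sub (h.integrable_sqrt_blockCount_div b) (integrable_const _)]
    simp [blockMean]
  calc |blockMean P z G b - √(p b)|
      ≤ ∫ ω, |√((blockCount z (G ω) b : ℝ) / m) - √(p b)| ∂P := by
        rw [hsub]
        exact abs_integral_le_integral_abs
    _ ≤ ∫ ω, (q / m ^ 2 * ((blockCount z (G ω) b : ℝ) - m * p b) ^ 2 + 1 / q) / √(p b) ∂P :=
        integral_mono ((h.integrable_sqrt_blockCount_div b).sub (integrable_const _)).abs hi2 hpt
    _ = (q / m ^ 2 * ∫ ω, ((blockCount z (G ω) b : ℝ) - m * p b) ^ 2 ∂P + 1 / q) / √(p b) := by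
        rw [integral_div, integral_add hi (integrable_const _), integral_const_mul]
        simp
    _ ≤ (q / m ^ 2 * m + 1 / q) / √(p b) := by
        have := h.integral_sq_blockCount_sub_le hp b
        gcongr
    _ = (q / m + 1 / q) / √(p b) := by
        congr 2
        field_simp

theorem IsSBM.ae_blockCount_eq_zero [IsFiniteMeasure P] (h : IsSBM P z B G)
    (hp : ∀ r s, p s(r, s) = B r s) {b : Sym2 (Fin k)} (hb : p b = 0) :
    ∀ᵐ ω ∂P, blockCount z (G ω) b = 0 := by
  have h1 : ∀ᵐ ω ∂P, ∀ e ∈ block z b, ω ∉ edgeEvent G e := by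
    rw [Finset.eventually_all]
    intro e he
    have : P.real (edgeEvent G e) = 0 := by
      rw [h.measureReal_edgeEvent hp, mem_block.1 he, hb]
    exact measure_eq_zero_iff_ae_notMem.1 ((measureReal_eq_zero_iff).1 this)
  filter_upwards [h1] with ω hω
  have : (blockCount z (G ω) b : ℝ) = 0 := by
    rw [blockCount_eq_sum_indicator]
    exact Finset.sum_eq_zero fun e he => Set.indicator_of_notMem (hω e he) _
  exact_mod_cast this

theorem IsSBM.blockMean_eq_zero [IsFiniteMeasure P] (h : IsSBM P z B G)
    (hp : ∀ r s, p s(r, s) = B r s) {b : Sym2 (Fin k)} (hb : p b = 0) :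
    blockMean P z G b = 0 := by
  refine integral_eq_zero_of_ae ?_
  filter_upwards [h.ae_blockCount_eq_zero hp hb] with ω hω
  simp [hω]

theorem IsSBM.integrable_Y [IsFiniteMeasure P] (h : IsSBM P z B G) (e : Edge n) :
    Integrable (fun ω => Y z (G ω) e) P := by
  classical
  refine integrable_of_abs_le (D := √(blockCount z ⊤ (e.1.map z) : ℝ)) ?_ fun ω => ?_
  · exact Measurable.ite (h.measurableSet_edgeEvent e)
      (measurable_const.div (h.measurable_blockCount _)).sqrt measurable_const
  · rw [Y]
    split_ifs with he
    · rw [abs_of_nonneg (Real.sqrt_nonneg _)]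
      -- If `e` is present then `m̂ ≥ 1`.
      refine Real.sqrt_le_sqrt (div_le_self (by positivity) ?_)
      have : 0 < blockCount z (G ω) (e.1.map z) := by
        rw [blockCount_eq_card]
        exact Finset.card_pos.2 ⟨e, Finset.mem_filter.2 ⟨mem_block.2 rfl, he⟩⟩
      exact_mod_cast this
    · simp

/-- By exchangeability all weights of a block have the same mean, and their sum is `m̂ √(m / m̂) = m
√(m̂ / m)`. Dividing by `m` gives the claim. -/
theorem IsSBM.integral_Y_eq_blockMean [IsProbabilityMeasure P] (h : IsSBM P z B G)
    (hp : ∀ r s, p s(r, s) = B r s) (e : Edge n) :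
    ∫ ω, Y z (G ω) e ∂P = blockMean P z G (e.1.map z) := by
  classical
  set b := e.1.map z with hb
  have he : e ∈ block z b := mem_block.2 rfl
  have hm : 0 < (blockCount z ⊤ b : ℝ) := by
    rw [blockCount_top]
    exact_mod_cast Finset.card_pos.2 ⟨e, he⟩
  have hsymm : ∀ f ∈ block z b, ∫ ω, Y z (G ω) f ∂P = ∫ ω, Y z (G ω) e ∂P := by
    intro f hf
    have key := integral_ite_card_filter_eq h.measurableSet_edgeEvent h.iIndepSet_edgeEvent
      (a := block z b) (p := p b)
      (fun i hi => (h.measureReal_edgeEvent hp i).trans (congrArg p (mem_block.1 hi)))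
      (fun j => √((blockCount z ⊤ b : ℝ) / (j : ℝ))) hf he
    have hY : ∀ f ∈ block z b, ∀ ω, Y z (G ω) f = if ω ∈ edgeEvent G f then
        √((blockCount z ⊤ b : ℝ) /
          (((block z b).filter fun i => ω ∈ edgeEvent G i).card : ℝ)) else 0 := by
      intro f hf ω
      simp only [Y, mem_block.1 hf, mem_edgeEvent, blockCount_eq_card z (G ω)]
    simp_rw [hY f hf, hY e he]
    exact key
  have hsum : ∀ ω, ∑ f ∈ block z b, Y z (G ω) f =
      blockCount z ⊤ b * √((blockCount z (G ω) b : ℝ) / blockCount z ⊤ b) := by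
    intro ω
    have h1 : ∑ f ∈ block z b, Y z (G ω) f =
        blockCount z (G ω) b * √((blockCount z ⊤ b : ℝ) / blockCount z (G ω) b) := by
      rw [blockCount_eq_card z (G ω), ← nsmul_eq_mul, ← Finset.sum_const, Finset.sum_filter]
      refine Finset.sum_congr rfl fun f hf => ?_
      simp only [Y, mem_block.1 hf, blockCount_eq_card z (G ω)]
    rw [h1]
    set x : ℝ := (blockCount z (G ω) b : ℝ)
    have hx : 0 ≤ x := by positivity
    rcases hx.eq_or_lt with hx0 | hx0
    -- With no realised edge both sides are zero, as division by zero gives zero.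
    · simp [← hx0]
    · rw [Real.sqrt_div hm.le, Real.sqrt_div hx]
      have hsx : 0 < √x := Real.sqrt_pos.2 hx0
      have hsm := Real.sqrt_pos.2 hm
      rw [mul_div_assoc', mul_div_assoc', div_eq_div_iff hsx.ne' hsm.ne']
      calc x * √(blockCount z ⊤ b : ℝ) * √(blockCount z ⊤ b : ℝ)
          = x * (blockCount z ⊤ b : ℝ) := by rw [mul_assoc, Real.mul_self_sqrt hm.le]
        _ = (blockCount z ⊤ b : ℝ) * √x * √x := by
            rw [mul_assoc, Real.mul_self_sqrt hx]; ring
  have h2 : (blockCount z ⊤ b : ℝ) * ∫ ω, Y z (G ω) e ∂P =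
      blockCount z ⊤ b * blockMean P z G b := by
    calc (blockCount z ⊤ b : ℝ) * ∫ ω, Y z (G ω) e ∂P
        = ∑ f ∈ block z b, ∫ ω, Y z (G ω) f ∂P := by
          rw [Finset.sum_congr rfl hsymm, Finset.sum_const, nsmul_eq_mul, blockCount_top]
      _ = ∫ ω, ∑ f ∈ block z b, Y z (G ω) f ∂P :=
          (integral_finsetSum _ fun f _ => h.integrable_Y f).symm
      _ = blockCount z ⊤ b * blockMean P z G b := by
          simp_rw [hsum]
          rw [integral_const_mul, blockMean]
  exact mul_left_cancel₀ hm.ne' h2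

end Blockmodel

/-! ### Perturbation estimates, Chebyshev bounds and the bound for one entry. -/

section Concentration

theorem abs_mul_sub_mul_le {a b x y d : ℝ} (hb : |b| ≤ 1) (hx : |x| ≤ 1)
    (h1 : |x - a| ≤ d) (h2 : |y - b| ≤ d) : |a * b - x * y| ≤ 2 * d := by
  have h : a * b - x * y = -((x - a) * b) - x * (y - b) := by ring
  have h3 : |x - a| * |b| ≤ d * 1 :=
    mul_le_mul h1 hb (abs_nonneg _) ((abs_nonneg _).trans h1)
  have h4 : |x| * |y - b| ≤ 1 * d := mul_le_mul hx h2 (abs_nonneg _) zero_le_one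
  rw [h]
  refine (abs_sub _ _).trans ?_
  rw [abs_neg, abs_mul, abs_mul]
  linarith

/-- Here `q` stands for `√n`, `m` for the entry of `M`, `τ` for `T / √(m_a m_b)`, `α`, `β` for the
roots of the edge probabilities, and `u`, `v` for the roots of the edge densities. An error `D / q`
in a bounded factor costs only order `q` after multiplication by `m ≤ L * q ^ 2`. -/
theorem abs_div_sub_le {τ m α β u v μ ν s D L q : ℝ} (hs : 0 < s) (hq : 0 < q) (hD : 0 ≤ D)
    (hL : 0 ≤ L) (hm0 : 0 ≤ m) (hm : m ≤ L * q ^ 2)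
    (hα0 : 0 ≤ α) (hα : α ≤ 1) (hβ0 : 0 ≤ β) (hβ : β ≤ 1) (hu0 : s ≤ u) (hu : u ≤ 1)
    (hv0 : s ≤ v) (hμ0 : 0 ≤ μ) (hμ : μ ≤ 1)
    (huα : |u - α| ≤ D / q) (hvβ : |v - β| ≤ D / q)
    (hμα : |μ - α| ≤ D / q) (hνβ : |ν - β| ≤ D / q)
    (hτ : |τ - α ^ 2 * β ^ 2 * m| ≤ D * q) :
    |τ / (u * v) - μ * m * ν| ≤ ((D + 2 * L * D) / s ^ 2 + 2 * L * D) * q := by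
  have hβ' : |β| ≤ 1 := by rwa [abs_of_nonneg hβ0]
  have h1 : |α * β - u * v| ≤ 2 * (D / q) :=
    abs_mul_sub_mul_le hβ' (by rwa [abs_of_nonneg (hs.le.trans hu0)]) huα hvβ
  have h2 : |α * β - μ * ν| ≤ 2 * (D / q) :=
    abs_mul_sub_mul_le hβ' (by rwa [abs_of_nonneg hμ0]) hμα hνβ
  have hu' : 0 < u := hs.trans_le hu0
  have hv' : 0 < v := hs.trans_le hv0
  have huv : s ^ 2 ≤ u * v := by
    rw [sq]
    exact mul_le_mul hu0 hv0 hs.le hu'.le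
  have hmq : ∀ t : ℝ, |t| ≤ 2 * (D / q) → |m * t| ≤ 2 * L * D * q := by
    intro t ht
    rw [abs_mul, abs_of_nonneg hm0]
    calc m * |t| ≤ L * q ^ 2 * (2 * (D / q)) := mul_le_mul hm ht (abs_nonneg _) (by positivity)
      _ = 2 * L * D * q := by field_simp
  have h3 : |m * (α * β * (α * β - u * v))| ≤ 2 * L * D * q := by
    refine hmq _ ?_
    rw [abs_mul, abs_of_nonneg (by positivity)]
    exact (mul_le_of_le_one_left (abs_nonneg _) (mul_le_one₀ hα hβ0 hβ)).trans h1
  have h4 := hmq _ h2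
  -- The three errors are those of the count `τ`, of the random normalization `u * v`, and of the
  -- means `μ * ν`.
  have hsplit : τ / (u * v) - μ * m * ν =
      ((τ - α ^ 2 * β ^ 2 * m) + m * (α * β * (α * β - u * v))) / (u * v)
        + m * (α * β - μ * ν) := by
    field_simp
    ring
  have h5 : |((τ - α ^ 2 * β ^ 2 * m) + m * (α * β * (α * β - u * v))) / (u * v)| ≤
      (D * q + 2 * L * D * q) / s ^ 2 := by
    rw [abs_div, abs_of_pos (mul_pos hu' hv')]
    exact div_le_div₀ (by positivity) ((abs_add_le _ _).trans (add_le_add hτ h3))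
      (by positivity) huv
  rw [hsplit]
  refine (abs_add_le _ _).trans ((add_le_add h5 h4).trans (le_of_eq ?_))
  ring

variable {n k : ℕ} {z : Fin n → Fin k} {B : Matrix (Fin k) (Fin k) ℝ} {p : Sym2 (Fin k) → ℝ}
  {Ω : Type*} [MeasurableSpace Ω] {P : Measure Ω} {G : Ω → SimpleGraph (Fin n)}

theorem IsSBM.measureReal_lt_abs_blockCount_le [IsProbabilityMeasure P] (h : IsSBM P z B G)
    (hp : ∀ r s, p s(r, s) = B r s) {c : ℝ} (hc : 0 < c) (hn : 0 < (n : ℝ)) {b : Sym2 (Fin k)}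
    (hm : c * (n : ℝ) ^ 2 ≤ blockCount z ⊤ b) :
    P.real {ω | (blockCount z ⊤ b : ℝ) / √n <
      |(blockCount z (G ω) b : ℝ) - blockCount z ⊤ b * p b|} ≤ 1 / c / n := by
  have hm0 : (0 : ℝ) < blockCount z ⊤ b := lt_of_lt_of_le (by positivity) hm
  refine (measureReal_lt_abs_le (h.integrable_sq_blockCount_sub b _) (by positivity)
    (h.integral_sq_blockCount_sub_le hp b)).trans ?_
  rw [div_pow, Real.sq_sqrt hn.le, div_div, div_div_eq_mul_div, div_le_div_iff₀ (by positivity)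
    (by positivity)]
  nlinarith [mul_le_mul_of_nonneg_left hm hm0.le]

theorem IsSBM.measureReal_lt_abs_adjCount_le [IsProbabilityMeasure P] (h : IsSBM P z B G)
    (hp : ∀ r s, p s(r, s) = B r s) (hn : 0 < (n : ℝ)) (a b : Sym2 (Fin k)) :
    P.real {ω | (n : ℝ) ^ 2 * √n <
      |adjCount z (G ω) a b - (adjPairs z a b).card * (p a * p b)|} ≤ 16 / n := by
  refine (measureReal_lt_abs_le (h.integrable_sq_adjCount_sub a b _) (by positivity)
    (h.integral_sq_adjCount_sub_le hp a b)).trans (le_of_eq ?_)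
  rw [mul_pow, Real.sq_sqrt hn.le]
  field_simp

/-- A bound on the entries when the edge counts are close to their expectations. -/
theorem abs_projectedAdj_sub_le {c s D : ℝ} (hc : 0 < c) (hs : 0 < s)
    (hn : 0 < (n : ℝ)) {H : SimpleGraph (Fin n)} {a b : Sym2 (Fin k)} {μ ν : ℝ}
    (hma : c * (n : ℝ) ^ 2 ≤ blockCount z ⊤ a) (hmb : c * (n : ℝ) ^ 2 ≤ blockCount z ⊤ b)
    (hpa : p a ≤ 1) (hpb : p b ≤ 1) (hsa : s ≤ √(p a)) (hsb : s ≤ √(p b))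
    (hμ0 : 0 ≤ μ) (hμ1 : μ ≤ 1) (hD : 1 / s ≤ D) (hDc : 1 / c ≤ D) (hDn : D / √n ≤ s / 2)
    (hμ : |μ - √(p a)| ≤ D / √n) (hν : |ν - √(p b)| ≤ D / √n)
    (ha : |(blockCount z H a : ℝ) - blockCount z ⊤ a * p a| ≤ (blockCount z ⊤ a : ℝ) / √n)
    (hb : |(blockCount z H b : ℝ) - blockCount z ⊤ b * p b| ≤ (blockCount z ⊤ b : ℝ) / √n)
    (hT : |adjCount z H a b - (adjPairs z a b).card * (p a * p b)| ≤ (n : ℝ) ^ 2 * √n) :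
    |projectedAdj z H a b - μ * M z a b * ν| ≤
      ((D + 2 * (2 / c) * D) / (s / 2) ^ 2 + 2 * (2 / c) * D) * √n := by
  have hq : 0 < √(n : ℝ) := Real.sqrt_pos.2 hn
  have hD0 : 0 ≤ D := le_trans (by positivity) hD
  have hroot : ∀ d : Sym2 (Fin k), c * (n : ℝ) ^ 2 ≤ blockCount z ⊤ d → s ≤ √(p d) →
      |(blockCount z H d : ℝ) - blockCount z ⊤ d * p d| ≤ (blockCount z ⊤ d : ℝ) / √n →
      |√((blockCount z H d : ℝ) / blockCount z ⊤ d) - √(p d)| ≤ D / √n ∧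
      s / 2 ≤ √((blockCount z H d : ℝ) / blockCount z ⊤ d) := by
    intro d hm hsd hd
    have hm0 : (0 : ℝ) < blockCount z ⊤ d := lt_of_lt_of_le (by positivity) hm
    have hpd : 0 < p d := Real.sqrt_pos.1 (hs.trans_le hsd)
    have h1 : |(blockCount z H d : ℝ) / blockCount z ⊤ d - p d| ≤ 1 / √n := by
      have : (blockCount z H d : ℝ) / blockCount z ⊤ d - p d =
          ((blockCount z H d : ℝ) - blockCount z ⊤ d * p d) / blockCount z ⊤ d := by
        field_simp
      rw [this, abs_div, abs_of_pos hm0, div_le_iff₀ hm0]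
      exact hd.trans (le_of_eq (by ring))
    have h2 : |√((blockCount z H d : ℝ) / blockCount z ⊤ d) - √(p d)| ≤ D / √n :=
      calc _ ≤ _ := abs_sqrt_sub_sqrt_le (by positivity) hpd
        _ ≤ 1 / √n / s := div_le_div₀ (by positivity) h1 hs hsd
        _ = 1 / s / √n := by rw [div_right_comm]
        _ ≤ D / √n := by gcongr
    exact ⟨h2, by linarith [(abs_le.1 h2).1]⟩
  have hma0 : (0 : ℝ) < blockCount z ⊤ a := lt_of_lt_of_le (by positivity) hma
  have hmb0 : (0 : ℝ) < blockCount z ⊤ b := lt_of_lt_of_le (by positivity) hmb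
  obtain ⟨hua, hua'⟩ := hroot a hma hsa ha
  obtain ⟨hub, hub'⟩ := hroot b hmb hsb hb
  set w : ℝ := √(blockCount z ⊤ a : ℝ) * √(blockCount z ⊤ b : ℝ) with hw
  have hw0 : 0 < w := mul_pos (Real.sqrt_pos.2 hma0) (Real.sqrt_pos.2 hmb0)
  have hcn : c * (n : ℝ) ^ 2 ≤ w := by
    have h0 : (0 : ℝ) ≤ c * (n : ℝ) ^ 2 := by positivity
    calc c * (n : ℝ) ^ 2 = √(c * (n : ℝ) ^ 2) * √(c * (n : ℝ) ^ 2) := (Real.mul_self_sqrt h0).symm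
      _ ≤ w := mul_le_mul (Real.sqrt_le_sqrt hma) (Real.sqrt_le_sqrt hmb) (Real.sqrt_nonneg _)
          (Real.sqrt_nonneg _)
  have hproj : projectedAdj z H a b = adjCount z H a b / w /
      (√((blockCount z H a : ℝ) / blockCount z ⊤ a) *
        √((blockCount z H b : ℝ) / blockCount z ⊤ b)) := by
    have h1 := (Real.sqrt_pos.2 hma0).ne'
    have h2 := (Real.sqrt_pos.2 hmb0).ne'
    rw [projectedAdj_apply, hw, Real.sqrt_div (by positivity), Real.sqrt_div (by positivity),
      div_div, div_mul_div_comm, mul_div_cancel₀ _ (mul_ne_zero h1 h2)]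
  have hpa0 : 0 ≤ p a := (Real.sqrt_pos.1 (hs.trans_le hsa)).le
  have hpb0 : 0 ≤ p b := (Real.sqrt_pos.1 (hs.trans_le hsb)).le
  rw [hproj, M_apply, ← hw]
  refine abs_div_sub_le (by positivity) hq hD0 (by positivity) (by positivity) ?_
    (Real.sqrt_nonneg _) (Real.sqrt_le_one.2 hpa) (Real.sqrt_nonneg _) (Real.sqrt_le_one.2 hpb)
    hua' (Real.sqrt_le_one.2 (blockCount_div_le_one _ _)) hub' hμ0 hμ1 hua hub hμ hν ?_
  · rw [Real.sq_sqrt hn.le, div_le_iff₀ hw0]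
    have hS : ((adjPairs z a b).card : ℝ) ≤ 2 * (n : ℝ) ^ 3 := by
      exact_mod_cast card_adjPairs_le z a b
    calc ((adjPairs z a b).card : ℝ) ≤ 2 * (n : ℝ) ^ 3 := hS
      _ = 2 / c * n * (c * (n : ℝ) ^ 2) := by field_simp
      _ ≤ 2 / c * n * w := by gcongr
  · rw [Real.sq_sqrt hpa0, Real.sq_sqrt hpb0]
    have h1 : adjCount z H a b / w - p a * p b * (((adjPairs z a b).card : ℝ) / w) =
        (adjCount z H a b - (adjPairs z a b).card * (p a * p b)) / w := by
      field_simp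
    rw [h1, abs_div, abs_of_pos hw0]
    calc _ ≤ (n : ℝ) ^ 2 * √n / (c * (n : ℝ) ^ 2) :=
          div_le_div₀ (by positivity) hT (by positivity) hcn
      _ = 1 / c * √n := by field_simp
      _ ≤ D * √n := by gcongr

/-- The constants are chosen before `n`. For positive probabilities, the three Chebyshev events are
the only exceptions once `n` is large. -/
theorem exists_entry_bound (hp : ∀ r s, p s(r, s) = B r s) (hp0 : ∀ b, 0 ≤ p b)
    (hp1 : ∀ b, p b ≤ 1) {c : ℝ} (hc : 0 < c) (a b : Sym2 (Fin k)) :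
    ∃ C K : ℝ, 0 ≤ C ∧ ∀ (n : ℕ) (z : Fin n → Fin k), 1 ≤ n →
      (∀ r, 2 ≤ clusterSize z r) → (∀ r, c * (n : ℝ) ≤ (clusterSize z r : ℝ)) →
      ∀ (Ω : Type*) [MeasurableSpace Ω] (P : Measure Ω) [IsProbabilityMeasure P]
        (G : Ω → SimpleGraph (Fin n)), IsSBM P z B G →
        P.real {ω | C * √n < |projectedAdj z (G ω) a b -
          blockMean P z G a * M z a b * blockMean P z G b|} ≤ K / n := by
  by_cases h0 : p a = 0 ∨ p b = 0
  · refine ⟨0, 0, le_rfl, fun n z _ _ _ Ω _ P _ G h => ?_⟩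
    have hz : ∀ᵐ ω ∂P, ¬ (0 * √n < |projectedAdj z (G ω) a b -
        blockMean P z G a * M z a b * blockMean P z G b|) := by
      rcases h0 with h0 | h0
      all_goals
        filter_upwards [h.ae_blockCount_eq_zero hp h0] with ω hω
        -- An empty block makes the denominator zero, and the quotient is then zero by convention.
        simp [projectedAdj_apply, hω, h.blockMean_eq_zero hp h0]
    have hnull : P {ω | 0 * √n < |projectedAdj z (G ω) a b -
        blockMean P z G a * M z a b * blockMean P z G b|} = 0 :=
      measure_eq_zero_iff_ae_notMem.2 hz
    rw [zero_div, measureReal_def, hnull, ENNReal.toReal_zero]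
  · push Not at h0
    have hpa : 0 < p a := (hp0 a).lt_of_ne' h0.1
    have hpb : 0 < p b := (hp0 b).lt_of_ne' h0.2
    set c' := c ^ 2 / 4 with hc'
    have hc0 : 0 < c' := by positivity
    set s := min √(p a) √(p b) with hsdef
    have hs : 0 < s := lt_min (Real.sqrt_pos.2 hpa) (Real.sqrt_pos.2 hpb)
    have hs1 : s ≤ 1 := (min_le_left _ _).trans (Real.sqrt_le_one.2 (hp1 a))
    -- This is the constant that `abs_blockMean_sub_le` yields for `q = √n`; because `s ≤ 1` it also
    -- dominates `1 / s` and `1 / c'`.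
    set D := (1 / c' + 1) / s with hDdef
    have hD : 1 / s ≤ D := by
      rw [hDdef]
      gcongr
      linarith [show 0 < 1 / c' by positivity]
    have hDc : 1 / c' ≤ D := by
      rw [hDdef, le_div_iff₀ hs]
      nlinarith [show 0 < 1 / c' by positivity]
    have hD0 : 0 < D := lt_of_lt_of_le (by positivity) hD
    refine ⟨(D + 2 * (2 / c') * D) / (s / 2) ^ 2 + 2 * (2 / c') * D,
      (2 * D / s) ^ 2 + (1 / c' + 1 / c' + 16), by positivity,
      fun n z hn1 h2 hcn Ω _ P _ G h => ?_⟩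
    have hn : (0 : ℝ) < n := by exact_mod_cast hn1
    have hq : 0 < √(n : ℝ) := Real.sqrt_pos.2 hn
    -- For small `n` the first summand of `K` makes the bound at least one. For large `n` the
    -- densities keep their roots above `s / 2`.
    by_cases hlarge : (n : ℝ) ≤ (2 * D / s) ^ 2
    · have h1 : 1 ≤ (2 * D / s) ^ 2 / n := (one_le_div hn).2 hlarge
      have h2 : 0 ≤ (1 / c' + 1 / c' + 16) / n := by positivity
      refine measureReal_le_one.trans ?_
      rw [add_div]
      linarith
    · have hDn : D / √n ≤ s / 2 := by
        have : 2 * D / s ≤ √n := Real.le_sqrt_of_sq_le (not_le.1 hlarge).le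
        rw [div_le_iff₀ hs] at this
        rw [div_le_div_iff₀ hq two_pos]
        linarith
      have hm := fun d => blockCount_top_ge hc h2 hcn d
      have hμ : ∀ d, 0 < p d → s ≤ √(p d) → |blockMean P z G d - √(p d)| ≤ D / √n := by
        intro d hd hsd
        refine (h.abs_blockMean_sub_le hp (blockCount_top_pos h2 d) hd hq).trans ?_
        have h1 : √n / blockCount z ⊤ d ≤ 1 / c' / √n := by
          rw [div_div, div_le_div_iff₀ (Nat.cast_pos.2 (blockCount_top_pos h2 d))
            (by positivity), one_mul]
          have h3 : √(n : ℝ) * (c' * √n) = c' * n := by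
            rw [mul_left_comm, Real.mul_self_sqrt hn.le]
          rw [h3]
          refine le_trans ?_ (hm d)
          gcongr
          nlinarith [show (1 : ℝ) ≤ n by exact_mod_cast hn1]
        calc (√n / blockCount z ⊤ d + 1 / √n) / √(p d)
            ≤ (1 / c' / √n + 1 / √n) / s := by gcongr
          _ = D / √n := by rw [hDdef]; field_simp
      set E₁ := {ω | (blockCount z ⊤ a : ℝ) / √n <
        |(blockCount z (G ω) a : ℝ) - blockCount z ⊤ a * p a|}
      set E₂ := {ω | (blockCount z ⊤ b : ℝ) / √n <
        |(blockCount z (G ω) b : ℝ) - blockCount z ⊤ b * p b|}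
      set E₃ := {ω | (n : ℝ) ^ 2 * √n <
        |adjCount z (G ω) a b - (adjPairs z a b).card * (p a * p b)|}
      have hE₁ : P.real E₁ ≤ 1 / c' / n := h.measureReal_lt_abs_blockCount_le hp hc0 hn (hm a)
      have hE₂ : P.real E₂ ≤ 1 / c' / n := h.measureReal_lt_abs_blockCount_le hp hc0 hn (hm b)
      have hE₃ : P.real E₃ ≤ 16 / n := h.measureReal_lt_abs_adjCount_le hp hn a b
      calc _ ≤ P.real (E₁ ∪ E₂ ∪ E₃) := by
            refine measureReal_mono fun ω hω => ?_
            by_contra hnot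
            simp only [E₁, E₂, E₃, Set.mem_union, Set.mem_ofPred_eq, not_or, not_lt] at hnot
            refine (Set.mem_ofPred_eq ▸ hω : _ < _).not_ge ?_
            exact abs_projectedAdj_sub_le hc0 hs hn (hm a) (hm b) (hp1 a) (hp1 b)
              (min_le_left _ _) (min_le_right _ _) (blockMean_nonneg P z G a)
              (h.blockMean_le_one a) hD hDc hDn (hμ a hpa (min_le_left _ _))
              (hμ b hpb (min_le_right _ _)) hnot.1.1 hnot.1.2 hnot.2
        _ ≤ P.real E₁ + P.real E₂ + P.real E₃ :=
            (measureReal_union_le _ _).trans (add_le_add_left (measureReal_union_le _ _) _)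
        _ ≤ 1 / c' / n + 1 / c' / n + 16 / n := add_le_add (add_le_add hE₁ hE₂) hE₃
        _ = (1 / c' + 1 / c' + 16) / n := by ring
        _ ≤ _ := by
            exact div_le_div_of_nonneg_right (le_add_of_nonneg_left (by positivity)) hn.le

theorem frobenius_norm_le_sum {m m' : Type*} [Fintype m] [Fintype m'] (A : Matrix m m' ℝ) :
    ‖A‖ ≤ ∑ x : m × m', |A x.1 x.2| := by
  have h : ‖A‖ = √(∑ x : m × m', |A x.1 x.2| ^ 2) := by
    rw [frobenius_norm_def, Real.sqrt_eq_rpow, Fintype.sum_prod_type]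
    simp
  rw [h]
  exact Real.sqrt_le_iff.2 ⟨Finset.sum_nonneg fun _ _ => abs_nonneg _,
    Finset.sum_sq_le_sq_sum_of_nonneg fun _ _ => abs_nonneg _⟩

end Concentration

end RandomLineGraph

theorem corollary2 :
    ∀ (k : ℕ) (B : Matrix (Fin k) (Fin k) ℝ), B.IsSymm → (∀ r s, B r s ∈ Set.Icc (0 : ℝ) 1) →
    ∀ c : ℝ, 0 < c →
    ∃ C K : ℝ, ∀ (n : ℕ) (z : Fin n → Fin k), 1 ≤ n →
      (∀ r, 2 ≤ clusterSize z r) → (∀ r, c * (n : ℝ) ≤ (clusterSize z r : ℝ)) →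
      ∀ (Ω : Type*) [MeasurableSpace Ω] (P : Measure Ω) [IsProbabilityMeasure P]
        (G : Ω → SimpleGraph (Fin n)), IsSBM P z B G →
        ∃ μ : Sym2 (Fin k) → ℝ,
          (∀ e ∈ (⊤ : SimpleGraph (Fin n)).edgeSet, μ (e.map z) = ∫ ω, Y z (G ω) e ∂P) ∧
          1 - K / (n : ℝ) ≤
            P.real {ω | ‖projectedAdj z (G ω) - Matrix.diagonal μ * M z * Matrix.diagonal μ‖
              ≤ C * (n : ℝ) ^ (3 / 4 : ℝ)} := by
  intro k B hB hB01 c hc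
  -- The symmetry of `B` lets it descend to unordered pairs of clusters.
  obtain ⟨p, hp⟩ : ∃ p : Sym2 (Fin k) → ℝ, ∀ r s, p s(r, s) = B r s :=
    ⟨Sym2.lift ⟨fun r s => B r s, fun r s => hB.apply s r⟩, fun _ _ => rfl⟩
  have hp01 : ∀ b, p b ∈ Set.Icc (0 : ℝ) 1 := by
    intro b
    induction b with
    | h r s => rw [hp]; exact hB01 r s
  choose C K hC hbound using
    exists_entry_bound hp (fun b => (hp01 b).1) (fun b => (hp01 b).2) hc
  refine ⟨∑ x : Sym2 (Fin k) × Sym2 (Fin k), C x.1 x.2,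
    ∑ x : Sym2 (Fin k) × Sym2 (Fin k), K x.1 x.2, fun n z hn h2 hcn Ω _ P _ G h => ?_⟩
  refine ⟨blockMean P z G, fun e he => (h.integral_Y_eq_blockMean hp ⟨e, he⟩).symm, ?_⟩
  set A := {ω | ‖projectedAdj z (G ω) -
    Matrix.diagonal (blockMean P z G) * M z * Matrix.diagonal (blockMean P z G)‖
      ≤ (∑ x : Sym2 (Fin k) × Sym2 (Fin k), C x.1 x.2) * (n : ℝ) ^ (3 / 4 : ℝ)}
  let bad : Sym2 (Fin k) × Sym2 (Fin k) → Set Ω := fun x =>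
    {ω | C x.1 x.2 * √n < |projectedAdj z (G ω) x.1 x.2 -
      blockMean P z G x.1 * M z x.1 x.2 * blockMean P z G x.2|}
  -- Covering the whole space and using subadditivity avoids any measurability question about `A`.
  have hcover : Set.univ ⊆ A ∪ ⋃ x ∈ Finset.univ, bad x := by
    intro ω _
    by_contra hnot
    simp only [Set.mem_union, Set.mem_iUnion, Finset.mem_univ, exists_const, not_or, not_exists,
      bad, Set.mem_ofPred_eq, not_lt] at hnot
    refine hnot.1 ((frobenius_norm_le_sum _).trans ?_)
    rw [Finset.sum_mul]
    refine Finset.sum_le_sum fun x _ => ?_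
    rw [Matrix.sub_apply, Matrix.mul_diagonal, Matrix.diagonal_mul]
    refine (hnot.2 x).trans (mul_le_mul_of_nonneg_left ?_ (hC _ _))
    -- As `n ≥ 1`, the exponent `1 / 2` may be raised to `3 / 4`.
    rw [Real.sqrt_eq_rpow]
    exact Real.rpow_le_rpow_of_exponent_le (by exact_mod_cast hn) (by norm_num)
  have h1 : (1 : ℝ) ≤ P.real A + P.real (⋃ x ∈ Finset.univ, bad x) := by
    rw [← probReal_univ (μ := P)]
    exact (measureReal_mono hcover).trans (measureReal_union_le _ _)
  have h3 : P.real (⋃ x ∈ Finset.univ, bad x) ≤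
      (∑ x : Sym2 (Fin k) × Sym2 (Fin k), K x.1 x.2) / n := by
    rw [Finset.sum_div]
    exact (measureReal_biUnion_finset_le _ _).trans
      (Finset.sum_le_sum fun x _ => hbound x.1 x.2 n z hn h2 hcn Ω P G h)
  linarith
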